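/- **Setting.** A binary-input output-symmetric (BIOS) memoryless channel has input alphabet $\mathbb F_2$, an output alphabet $\mathcal Y$ (discrete or continuous) and transition probabilities given by densities $P(y|0),P(y|1)$ with respect to a $\sigma$-finite reference measure $\mu$ on $\mathcal Y$ (counting measure in the discrete case, e.g. Lebesgue measure in the continuous case), such that $P(y|1)=P(\pi(y)|0)$ for all $y$, for some $\mu$-preserving map $\pi:\mathcal Y\to\mathcal Y$ with $\pi(\pi(y))=y$. For $n$ uses, $P(\boldsymbol y|\boldsymbol x)=\prod_{i=0}^{n-1}P(y_i|x_i)$. Its capacity, in bits per channel use, is $$C_{\rm BIOS}=I(X;Y)=\frac12\sum_{x\in\mathbb F_2}\int_{\mathcal Y}P(y|x)\log_2\frac{P(y|x)}{\frac12P(y|0)+\frac12P(y|1)}\,d\mu(y)$$ ($X$ uniform on $\mathbb F_2$). A *profile* of length $n$ is a $k$-tuple $\boldsymbol w=(w_0,\dots,w_{k-1})$ of positive integers with $\sum_\ell w_\ell=n$. A *staircase generator matrix* with profile $\boldsymbol w$ is a binary $k\times n$ matrix $\mathbf G$ whose $\ell$-th row is $(\boldsymbol h_\ell,\boldsymbol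 i_\ell,\boldsymbol j_\ell)$, where $\boldsymbol h_\ell$ is an arbitrary binary sequence of length $\sum_{i<\ell}w_i$, $\boldsymbol i_\ell$ is the all-one sequence of length $w_\ell$ and $\boldsymbol j_\ell$ is the all-zero sequence of length $n-\sum_{i\le \ell}w_i$. The *random staircase generator matrix code* with profile $\boldsymbol w$ has all entries of the $\boldsymbol h_\ell$ chosen as independent fair bits. A message $\boldsymbol U$, uniform on $\mathbb F_2^k$, is sent as the codeword $\boldsymbol U\mathbf G$; a maximum-likelihood (ML) decoder maps each received $\boldsymbol y$ to a message $\hat{\boldsymbol U}$ maximizing $P(\boldsymbol y|\boldsymbol u\mathbf G)$ over $\boldsymbol u\in\mathbb F_2^k$, ties being broken arbitrarily; ${\rm FER}=\Pr\{\hat{\boldsymbol U}\ne\boldsymbol U\}$. **Theorem 2.** Consider a BIOS memoryless channel. For every $\epsilon>0$ and every $\delta$ with $0<\delta<C_{\rm BIOS}$ there is an integer $n_T$ such that for all $n\ge n_T$ and $k=\lceil n(C_{\rm BIOS}-\delta)\rceil$ one has $0<k<n$ and $C_{\rm BIOS}-\delta\le k/n<C_{\rm BIOS}$, and there is a profile $\boldsymbol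 w=(w_0,\dots,w_{k-1})$ of length $n$ such that 1. there exists a staircase generator matrix $\mathbf G$ with profile $\boldsymbol w$ whose frame error rate under ML decoding (with any tie-breaking) satisfies ${\rm FER}\le\epsilon$; and 2. the average of the ML frame error rate over the random staircase generator matrix code with profile $\boldsymbol w$ is at most $\epsilon$ (with any tie-breaking). In other words, random staircase generator matrix codes achieve the capacity of BIOS memoryless channels. -/

import Mathlib

open MeasureTheory
open scoped NNReal ENNReal

noncomputable section

/-- A binary-input output-symmetric (BIOS) channel with output alphabet `Y`. The transition
probabilities are given by densities `p x` with respect to a σ-finite reference measure `μ`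
(counting measure for a discrete channel, Lebesgue measure for a continuous one).
Symmetry is with respect to an involution `π` of the output alphabet that preserves `μ`
(for the counting measure every involution does). -/
structure BIOSChannel (Y : Type*) [MeasurableSpace Y] where
  /-- the reference measure -/
  μ : Measure Y
  sigmaFinite : SigmaFinite μ
  /-- `p x y` is the transition probability (density) `P(y | x)` -/
  p : ZMod 2 → Y → ℝ≥0
  measurable_p : ∀ x, Measurable (p x)
  lintegral_p : ∀ x, ∫⁻ y, (p x y : ℝ≥0∞) ∂μ = 1
  /-- the symmetry of the output alphabet -/
  π : Y → Y
  involutive_π : Function.Involutive π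
  measurePreserving_π : MeasurePreserving π μ μ
  symm : ∀ y, p 1 y = p 0 (π y)

namespace BIOSChannel

variable {Y : Type*} [MeasurableSpace Y] (W : BIOSChannel Y)

/-- The output density `P(y) = (1 - r) P(y|0) + r P(y|1)` for the input law `P(1) = r`. -/
def outputDensity (r : ℝ) (y : Y) : ℝ :=
  (1 - r) * (W.p 0 y : ℝ) + r * (W.p 1 y : ℝ)

/-- The partial mutual information `I_x(r) = ∑_y P(y|x) log (P(y|x) / P(y))`, in bits.
At a point with `P(y|x) = 0` the integrand is `0`. -/
def partialMutualInfo (x : ZMod 2) (r : ℝ) : ℝ :=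
  ∫ y, (W.p x y : ℝ) * Real.logb 2 ((W.p x y : ℝ) / W.outputDensity r y) ∂W.μ

/-- The mutual information `I(X; Y)`, in bits, for the input law `P(1) = r`, `P(0) = 1 - r`. -/
def mutualInfo (r : ℝ) : ℝ :=
  (1 - r) * W.partialMutualInfo 0 r + r * W.partialMutualInfo 1 r

/-- The capacity of a BIOS channel: `I(X; Y)` for a uniform input, in bits per channel use. -/
def capacity : ℝ := W.mutualInfo (1 / 2)

/-- The law of the channel output when the symbol `x` is sent. -/
def law (x : ZMod 2) : Measure Y := W.μ.withDensity fun y => (W.p x y : ℝ≥0∞)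

/-- The law of the output sequence when the word `c` is sent (memoryless channel). -/
def wordLaw {n : ℕ} (c : Fin n → ZMod 2) : Measure (Fin n → Y) :=
  Measure.pi fun i => W.law (c i)

/-- The likelihood `P(y | c) = ∏ᵢ P(yᵢ | cᵢ)`. -/
def likelihood {n : ℕ} (c : Fin n → ZMod 2) (y : Fin n → Y) : ℝ≥0 :=
  ∏ i, W.p (c i) (y i)

/-- `dec` is a maximum-likelihood decoder for the code with generator matrix `G`, where the
message `u` is encoded as `u G`: for every received `y` it outputs a message of maximal
likelihood. Ties may be broken in any way. -/
def IsMLDecoder {k n : ℕ} (G : Matrix (Fin k) (Fin n) (ZMod 2))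
    (dec : (Fin n → Y) → (Fin k → ZMod 2)) : Prop :=
  ∀ (y : Fin n → Y) (u : Fin k → ZMod 2),
    W.likelihood (Matrix.vecMul u G) y ≤ W.likelihood (Matrix.vecMul (dec y) G) y

/-- The frame error rate `Pr{Û ≠ U}` for a message `U` uniform on `𝔽₂ᵏ`. -/
def FER {k n : ℕ} (G : Matrix (Fin k) (Fin n) (ZMod 2))
    (dec : (Fin n → Y) → (Fin k → ZMod 2)) : ℝ :=
  (∑ u : Fin k → ZMod 2, (W.wordLaw (Matrix.vecMul u G)).real {y | dec y ≠ u}) / 2 ^ k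

end BIOSChannel

/-- `w` is a profile of length `n`: positive widths `w₀, …, w_{k-1}` with sum `n`. -/
def IsProfile {k : ℕ} (n : ℕ) (w : Fin k → ℕ) : Prop :=
  (∀ l, 0 < w l) ∧ ∑ l, w l = n

/-- The column at which the `l`-th staircase starts, `w₀ + ⋯ + w_{l-1}`. -/
def stairStart {k : ℕ} (w : Fin k → ℕ) (l : Fin k) : ℕ := ∑ i ∈ Finset.univ.filter (· < l), w i

/-- `G` is a staircase matrix with widths `w`: row `l` is arbitrary before column
`stairStart w l`, then has `w l` ones, then zeros. -/
def IsStaircase {k n : ℕ} (w : Fin k → ℕ) (G : Matrix (Fin k) (Fin n) (ZMod 2)) : Prop :=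
  ∀ (l : Fin k) (j : Fin n),
    (stairStart w l ≤ (j : ℕ) → (j : ℕ) < stairStart w l + w l → G l j = 1) ∧
    (stairStart w l + w l ≤ (j : ℕ) → G l j = 0)

open Classical in
/-- The support of the random staircase ensemble with widths `w`. Choosing the entries to the
left of the staircase as independent fair bits is choosing a uniform element of this set. -/
def staircaseEnsemble {k : ℕ} (n : ℕ) (w : Fin k → ℕ) :
    Finset (Matrix (Fin k) (Fin n) (ZMod 2)) :=
  Finset.univ.filter fun G => IsStaircase w G

/-- The average frame error rate of the random staircase ensemble with widths `w`, where the
code with generator matrix `G` is decoded by `dec G`. -/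
def BIOSChannel.avgFER {Y : Type*} [MeasurableSpace Y] (W : BIOSChannel Y) {k n : ℕ}
    (w : Fin k → ℕ)
    (dec : Matrix (Fin k) (Fin n) (ZMod 2) → (Fin n → Y) → (Fin k → ZMod 2)) : ℝ :=
  (∑ G ∈ staircaseEnsemble n w, W.FER G (dec G)) / ((staircaseEnsemble n w).card : ℝ)

end

/-!
By the symmetry of the channel, the frame error rate of a linear code is at most the probability,
when the zero word is sent, that some nonzero codeword is at least as likely. Sort the messages by
their last nonzero entry `l`. There are `2 ^ l` of them, and the codeword of each in a random
staircase code is uniform before the `l`-th stair, `1` on it and `0` after it, so a product of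
functions of its symbols averages column by column.

With `M = E[(P(Y) / P(Y|0)) ^ ρ]` and `B = E[(P(Y|1) / P(Y|0)) ^ ρ]`, where `P(y)` is the output
density of a uniform input and `Y` is the output for the input `0`, Gallager's bound
`min 1 x ≤ x ^ ρ` makes the contribution of `l` at most `2 ^ (ρ l) * M ^ start * B ^ width`. The
derivative of `M` at `ρ = 0` is `-C log 2`, so for every `c < C` some `ρ` has `M ≤ 2 ^ (-ρ c)`, and
`B + 1 ≤ 2 M ≤ M + 1` gives `B ≤ M`. Hence only the end `start + width` of a stair matters. If the
first of `m + 1` stairs has width `n - m` and the others width one, the `l`-th ends at `n - m + l`,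
every term is at most `2 ^ (ρ (m - c n))` because `c ≤ 1`, and the sum vanishes exponentially when
`m / n` stays below `c`.
-/

open Filter Topology

theorem zmod_two_eq_zero_or_one : ∀ x : ZMod 2, x = 0 ∨ x = 1 := by decide

section TiltedMoments

theorem rpow_le_one_add_mul_sub_one {x ρ : ℝ} (hx : 0 ≤ x) (h0 : 0 ≤ ρ) (h1 : ρ ≤ 1) :
    x ^ ρ ≤ 1 + ρ * (x - 1) := by
  simpa using rpow_one_add_le_one_add_mul_self (s := x - 1) (by linarith) h0 h1

theorem log_le_inv_mul_rpow_sub_one {x ρ : ℝ} (hx : 0 < x) (hρ : 0 < ρ) :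
    Real.log x ≤ ρ⁻¹ * (x ^ ρ - 1) := by
  rw [inv_mul_eq_div, le_div_iff₀ hρ, Real.rpow_def_of_pos hx]
  linarith [Real.add_one_le_exp (Real.log x * ρ)]

theorem le_rpow_of_le_one_of_le {x a ρ : ℝ} (hx : 0 ≤ x) (hx1 : x ≤ 1) (hxa : x ≤ a)
    (h0 : 0 ≤ ρ) (h1 : ρ ≤ 1) : x ≤ a ^ ρ :=
  (Real.self_le_rpow_of_le_one hx hx1 h1).trans (Real.rpow_le_rpow hx hxa h0)

variable {Ω : Type*} [MeasurableSpace Ω] {ν : Measure Ω} {f : Ω → ℝ}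

theorem integrable_rpow_of_le_one [IsFiniteMeasure ν] (hf : Integrable f ν) (hf0 : 0 ≤ᵐ[ν] f)
    {ρ : ℝ} (h0 : 0 ≤ ρ) (h1 : ρ ≤ 1) : Integrable (fun ω => f ω ^ ρ) ν := by
  refine ((integrable_const 1).add ((hf.sub (integrable_const 1)).const_mul ρ)).mono'
    (hf.aemeasurable.pow_const ρ).aestronglyMeasurable ?_
  filter_upwards [hf0] with ω hω
  rw [Real.norm_of_nonneg (Real.rpow_nonneg hω ρ)]
  exact rpow_le_one_add_mul_sub_one hω h0 h1

theorem tendsto_integral_inv_mul_rpow_sub_one [IsFiniteMeasure ν] (hpos : ∀ᵐ ω ∂ν, 0 < f ω)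
    (hf : Integrable f ν) (hlog : Integrable (fun ω => Real.log (f ω)) ν) :
    Tendsto (fun ρ : ℝ => ∫ ω, ρ⁻¹ * (f ω ^ ρ - 1) ∂ν) (𝓝[>] 0)
      (𝓝 (∫ ω, Real.log (f ω) ∂ν)) := by
  refine tendsto_integral_filter_of_dominated_convergence
    (fun ω => |Real.log (f ω)| + |f ω - 1|) ?_ ?_
    (hlog.abs.add (hf.sub (integrable_const 1)).abs) ?_
  · exact Eventually.of_forall fun ρ =>
      (((hf.aemeasurable.pow_const ρ).sub_const 1).const_mul ρ⁻¹).aestronglyMeasurable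
  · filter_upwards [Ioc_mem_nhdsGT (zero_lt_one' ℝ)] with ρ ⟨hρ0, hρ1⟩
    filter_upwards [hpos] with ω hω
    have hlower := log_le_inv_mul_rpow_sub_one hω hρ0
    have hupper : ρ⁻¹ * (f ω ^ ρ - 1) ≤ f ω - 1 := by
      rw [inv_mul_le_iff₀ hρ0]
      linarith [rpow_le_one_add_mul_sub_one hω.le hρ0.le hρ1]
    rw [Real.norm_eq_abs, abs_le]
    constructor <;>
      linarith [neg_abs_le (Real.log (f ω)), abs_nonneg (Real.log (f ω)),
        le_abs_self (f ω - 1), abs_nonneg (f ω - 1)]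
  · filter_upwards [hpos] with ω hω using tendsto_rpow_sub_one_log hω

theorem exists_integral_rpow_le_exp [IsProbabilityMeasure ν] (hpos : ∀ᵐ ω ∂ν, 0 < f ω)
    (hf : Integrable f ν) (hlog : Integrable (fun ω => Real.log (f ω)) ν) {c : ℝ}
    (hc : ∫ ω, Real.log (f ω) ∂ν < c) :
    ∃ ρ ∈ Set.Ioc (0 : ℝ) 1, ∫ ω, f ω ^ ρ ∂ν ≤ Real.exp (ρ * c) := by
  obtain ⟨ρ, hlt, hρ⟩ := (((tendsto_integral_inv_mul_rpow_sub_one hpos hf hlog).eventually_lt_const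
    hc).and (Ioc_mem_nhdsGT zero_lt_one)).exists
  refine ⟨ρ, hρ, ?_⟩
  rw [integral_const_mul, inv_mul_lt_iff₀ hρ.1,
    integral_sub (integrable_rpow_of_le_one hf (hpos.mono fun _ => le_of_lt) hρ.1.le hρ.2)
      (integrable_const 1), integral_const, probReal_univ, one_smul] at hlt
  linarith [Real.add_one_le_exp (ρ * c)]

end TiltedMoments

namespace BIOSChannel

variable {Y : Type*} [MeasurableSpace Y] (W : BIOSChannel Y)

instance isProbabilityMeasure_law (x : ZMod 2) : IsProbabilityMeasure (W.law x) :=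
  ⟨by simp [law, W.lintegral_p x]⟩

instance isProbabilityMeasure_wordLaw {n : ℕ} (c : Fin n → ZMod 2) :
    IsProbabilityMeasure (W.wordLaw c) := by
  unfold wordLaw; infer_instance

theorem ae_law_p_pos (x : ZMod 2) : ∀ᵐ y ∂W.law x, 0 < W.p x y := by
  rw [law, ae_withDensity_iff (W.measurable_p x).coe_nnreal_ennreal]
  exact ae_of_all _ fun y hy => pos_iff_ne_zero.2 (by simpa using hy)

theorem ae_wordLaw_p_pos {n : ℕ} (c : Fin n → ZMod 2) :
    ∀ᵐ y ∂W.wordLaw c, ∀ i, 0 < W.p (c i) (y i) :=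
  ae_all_iff.2 fun i => (measurePreserving_eval (fun i => W.law (c i)) i
    ).quasiMeasurePreserving.ae (W.ae_law_p_pos (c i))

theorem integrable_p (x : ZMod 2) : Integrable (fun y => (W.p x y : ℝ)) W.μ := by
  refine ⟨(W.measurable_p x).coe_nnreal_real.aestronglyMeasurable, ?_⟩
  simp [HasFiniteIntegral, Real.enorm_eq_ofReal, W.lintegral_p x]

section Symmetry

/-- The symmetry of the output alphabet that undoes a translation of the input by `x`. -/
noncomputable def outputShift (x : ZMod 2) : Y → Y := if x = 0 then id else W.π

theorem p_add (x d : ZMod 2) (y : Y) : W.p (x + d) y = W.p d (W.outputShift x y) := by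
  have hπ : W.p 0 y = W.p 1 (W.π y) := by rw [W.symm, W.involutive_π]
  rcases zmod_two_eq_zero_or_one x with rfl | rfl <;>
    rcases zmod_two_eq_zero_or_one d with rfl | rfl
  · simp [outputShift]
  · simp [outputShift]
  · simpa [outputShift] using W.symm y
  · simpa [outputShift, show (1 : ZMod 2) + 1 = 0 from rfl] using hπ

theorem measurePreserving_outputShift_μ (x : ZMod 2) :
    MeasurePreserving (W.outputShift x) W.μ W.μ := by
  unfold outputShift
  split_ifs
  · exact MeasurePreserving.id _
  · exact W.measurePreserving_π

theorem measurePreserving_outputShift_law (x : ZMod 2) :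
    MeasurePreserving (W.outputShift x) (W.law x) (W.law 0) := by
  have hμ := W.measurePreserving_outputShift_μ x
  refine ⟨hμ.measurable, Measure.ext fun s hs => ?_⟩
  rw [Measure.map_apply hμ.measurable hs, law, law, withDensity_apply _ hs,
    withDensity_apply _ (hμ.measurable hs),
    ← hμ.setLIntegral_comp_preimage hs (W.measurable_p 0).coe_nnreal_ennreal]
  simp only [← W.p_add, add_zero]

variable {n : ℕ}

theorem measurePreserving_outputShift_wordLaw (c : Fin n → ZMod 2) :
    MeasurePreserving (fun y i => W.outputShift (c i) (y i)) (W.wordLaw c) (W.wordLaw 0) :=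
  measurePreserving_pi _ _ fun i => W.measurePreserving_outputShift_law (c i)

theorem likelihood_add (c d : Fin n → ZMod 2) (y : Fin n → Y) :
    W.likelihood (c + d) y = W.likelihood d fun i => W.outputShift (c i) (y i) :=
  Finset.prod_congr rfl fun i _ => W.p_add (c i) (d i) (y i)

end Symmetry

section LikelihoodRatio

/-- The likelihood ratio `P(y|x) / P(y|0)`, with value `0` where `P(y|0) = 0`. -/
noncomputable def likelihoodRatio (x : ZMod 2) (y : Y) : ℝ := W.p x y / W.p 0 y

/-- The likelihood ratio `P(y) / P(y|0)` of a uniform input against the input `0`, with value `0`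
where `P(y|0) = 0`. -/
noncomputable def outputRatio (y : Y) : ℝ := W.outputDensity (1 / 2) y / W.p 0 y

theorem outputRatio_eq_half_add (y : Y) :
    W.outputRatio y = (W.likelihoodRatio 0 y + W.likelihoodRatio 1 y) / 2 := by
  rw [outputRatio, outputDensity, likelihoodRatio, likelihoodRatio]
  ring

theorem likelihoodRatio_nonneg (x : ZMod 2) (y : Y) : 0 ≤ W.likelihoodRatio x y := by
  unfold likelihoodRatio; positivity

theorem likelihoodRatio_zero {y : Y} (hy : 0 < W.p 0 y) : W.likelihoodRatio 0 y = 1 :=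
  div_self (NNReal.coe_ne_zero.2 hy.ne')

theorem outputRatio_nonneg (y : Y) : 0 ≤ W.outputRatio y := by
  rw [outputRatio_eq_half_add]
  linarith [W.likelihoodRatio_nonneg 0 y, W.likelihoodRatio_nonneg 1 y]

theorem half_le_outputRatio {y : Y} (hy : 0 < W.p 0 y) : 1 / 2 ≤ W.outputRatio y := by
  rw [outputRatio_eq_half_add, W.likelihoodRatio_zero hy]
  linarith [W.likelihoodRatio_nonneg 1 y]

theorem measurable_likelihoodRatio (x : ZMod 2) : Measurable (W.likelihoodRatio x) :=
  (W.measurable_p x).coe_nnreal_real.div (W.measurable_p 0).coe_nnreal_real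

theorem measurable_outputRatio : Measurable W.outputRatio := by
  rw [funext W.outputRatio_eq_half_add]
  exact ((W.measurable_likelihoodRatio 0).add (W.measurable_likelihoodRatio 1)).div_const 2

theorem integrable_likelihoodRatio (x : ZMod 2) :
    Integrable (W.likelihoodRatio x) (W.law 0) := by
  rw [law, integrable_withDensity_iff_integrable_smul (W.measurable_p 0)]
  refine (W.integrable_p x).mono' ((W.measurable_p 0).coe_nnreal_real.mul
    (W.measurable_likelihoodRatio x)).aestronglyMeasurable (ae_of_all _ fun y => ?_)
  rw [NNReal.smul_def, smul_eq_mul,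
    Real.norm_of_nonneg (mul_nonneg (NNReal.coe_nonneg _) (W.likelihoodRatio_nonneg x y)),
    likelihoodRatio, mul_div_left_comm]
  exact mul_le_of_le_one_right (NNReal.coe_nonneg _) (div_self_le_one _)

theorem integrable_outputRatio : Integrable W.outputRatio (W.law 0) := by
  rw [funext W.outputRatio_eq_half_add]
  exact ((W.integrable_likelihoodRatio 0).add (W.integrable_likelihoodRatio 1)).div_const 2

theorem integrable_log_outputRatio :
    Integrable (fun y => Real.log (W.outputRatio y)) (W.law 0) := by
  refine (W.integrable_outputRatio.add (integrable_const 2)).mono'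
    W.measurable_outputRatio.log.aestronglyMeasurable ?_
  filter_upwards [W.ae_law_p_pos 0] with y hy
  have hhalf := W.half_le_outputRatio hy
  have hlower := Real.one_sub_inv_le_log_of_pos (one_half_pos.trans_le hhalf)
  have hupper := Real.log_le_sub_one_of_pos (one_half_pos.trans_le hhalf)
  have hinv : (W.outputRatio y)⁻¹ ≤ 2 := inv_le_of_inv_le₀ two_pos (by simpa using hhalf)
  rw [Real.norm_eq_abs, abs_le, Pi.add_apply]
  constructor <;> linarith

end LikelihoodRatio

section Capacity

theorem outputDensity_half_outputShift (x : ZMod 2) (y : Y) :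
    W.outputDensity (1 / 2) (W.outputShift x y) = W.outputDensity (1 / 2) y := by
  simp only [outputDensity, ← W.p_add]
  rcases zmod_two_eq_zero_or_one x with rfl | rfl
  · simp
  · rw [add_zero, show (1 : ZMod 2) + 1 = 0 from rfl]
    ring

theorem partialMutualInfo_half (x : ZMod 2) :
    W.partialMutualInfo x (1 / 2) = -∫ y, Real.logb 2 (W.outputRatio y) ∂W.law 0 := by
  have hshift (y : Y) : Real.logb 2 (W.p x y / W.outputDensity (1 / 2) y) =
      -Real.logb 2 (W.outputRatio (W.outputShift x y)) := by
    rw [outputRatio, outputDensity_half_outputShift, ← W.p_add, add_zero, ← Real.logb_inv, inv_div]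
  calc W.partialMutualInfo x (1 / 2)
      = ∫ y, Real.logb 2 (W.p x y / W.outputDensity (1 / 2) y) ∂W.law x :=
        (integral_withDensity_eq_integral_smul (W.measurable_p x) _).symm
    _ = -∫ y, Real.logb 2 (W.outputRatio (W.outputShift x y)) ∂W.law x := by
        simp only [hshift, integral_neg]
    _ = -∫ y, Real.logb 2 (W.outputRatio y) ∂W.law 0 := by
        have hmp := W.measurePreserving_outputShift_law x
        have hlogb : Measurable fun y => Real.logb 2 (W.outputRatio y) :=
          W.measurable_outputRatio.log.div_const _
        rw [← hmp.map_eq, integral_map hmp.measurable.aemeasurable hlogb.aestronglyMeasurable]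

theorem capacity_mul_log_two :
    W.capacity * Real.log 2 = -∫ y, Real.log (W.outputRatio y) ∂W.law 0 := by
  rw [capacity, mutualInfo, partialMutualInfo_half, partialMutualInfo_half]
  simp only [Real.logb, integral_div]
  have := Real.log_pos one_lt_two
  field_simp
  ring

theorem capacity_le_one : W.capacity ≤ 1 := by
  refine le_of_mul_le_mul_right ?_ (Real.log_pos one_lt_two)
  rw [capacity_mul_log_two, one_mul, neg_le]
  calc -Real.log 2 = ∫ _, -Real.log 2 ∂W.law 0 := by simp
    _ ≤ ∫ y, Real.log (W.outputRatio y) ∂W.law 0 := by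
        refine integral_mono_ae (integrable_const _) W.integrable_log_outputRatio ?_
        filter_upwards [W.ae_law_p_pos 0] with y hy
        rw [← Real.log_inv]
        exact Real.log_le_log (by norm_num) (by simpa using W.half_le_outputRatio hy)

theorem exists_integral_outputRatio_rpow_le {c : ℝ} (hc : c < W.capacity) :
    ∃ ρ ∈ Set.Ioc (0 : ℝ) 1, ∫ y, W.outputRatio y ^ ρ ∂W.law 0 ≤ 2 ^ (-(ρ * c)) := by
  have hpos : ∀ᵐ y ∂W.law 0, 0 < W.outputRatio y := by
    filter_upwards [W.ae_law_p_pos 0] with y hy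
      using one_half_pos.trans_le (W.half_le_outputRatio hy)
  have hlog : ∫ y, Real.log (W.outputRatio y) ∂W.law 0 < -(c * Real.log 2) := by
    rw [lt_neg, ← W.capacity_mul_log_two]
    exact mul_lt_mul_of_pos_right hc (Real.log_pos one_lt_two)
  obtain ⟨ρ, hρ, hle⟩ := exists_integral_rpow_le_exp hpos W.integrable_outputRatio
    W.integrable_log_outputRatio hlog
  refine ⟨ρ, hρ, hle.trans_eq ?_⟩
  rw [Real.rpow_def_of_pos two_pos]
  ring_nf

/-- Concavity of `t ↦ t ^ ρ`, applied to `P(y) = (P(y|0) + P(y|1)) / 2`. -/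
theorem integral_likelihoodRatio_one_rpow_add_one_le {ρ : ℝ} (h0 : 0 ≤ ρ) (h1 : ρ ≤ 1) :
    ∫ y, W.likelihoodRatio 1 y ^ ρ ∂W.law 0 + 1 ≤ 2 * ∫ y, W.outputRatio y ^ ρ ∂W.law 0 := by
  have hint := integrable_rpow_of_le_one (W.integrable_likelihoodRatio 1)
    (ae_of_all _ (W.likelihoodRatio_nonneg 1)) h0 h1
  have hint' := integrable_rpow_of_le_one W.integrable_outputRatio
    (ae_of_all _ W.outputRatio_nonneg) h0 h1
  calc ∫ y, W.likelihoodRatio 1 y ^ ρ ∂W.law 0 + 1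
      = ∫ y, (W.likelihoodRatio 1 y ^ ρ + 1) ∂W.law 0 := by
        rw [integral_add hint (integrable_const 1)]; simp
    _ ≤ ∫ y, 2 * W.outputRatio y ^ ρ ∂W.law 0 := by
        refine integral_mono_ae (hint.add (integrable_const 1)) (hint'.const_mul 2) ?_
        filter_upwards [W.ae_law_p_pos 0] with y hy
        have hconc := (Real.concaveOn_rpow h0 h1).2 (Set.mem_Ici.2 zero_le_one)
          (W.likelihoodRatio_nonneg 1 y) one_half_pos.le one_half_pos.le (add_halves 1)
        simp only [smul_eq_mul, Real.one_rpow, ← mul_add] at hconc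
        rw [outputRatio_eq_half_add, W.likelihoodRatio_zero hy, div_eq_inv_mul, ← one_div]
        linarith
    _ = 2 * ∫ y, W.outputRatio y ^ ρ ∂W.law 0 := integral_const_mul _ _

end Capacity

end BIOSChannel

theorem prod_fin_ite_lt {M : Type*} [CommMonoid M] {n s w : ℕ} (h : s + w ≤ n) (a b : M) :
    ∏ i : Fin n, (if (i : ℕ) < s then a else if (i : ℕ) < s + w then b else 1) =
      a ^ s * b ^ w := by
  obtain ⟨m, rfl⟩ := Nat.exists_eq_add_of_le h
  simp [Fin.prod_univ_add, show ∀ x, ¬s + w + x < s by lia]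

section Messages

variable {k : ℕ} {l : Fin k} {v : Fin k → ZMod 2}

/-- The messages whose last nonzero entry is the `l`-th. -/
def messagesWithLast (l : Fin k) : Finset (Fin k → ZMod 2) :=
  Fintype.piFinset fun j => if j < l then Finset.univ else if j = l then {1} else {0}

theorem apply_eq_one_of_mem_messagesWithLast (hv : v ∈ messagesWithLast l) : v l = 1 := by
  simpa using Fintype.mem_piFinset.1 hv l

theorem apply_eq_zero_of_mem_messagesWithLast (hv : v ∈ messagesWithLast l) {j : Fin k}
    (hj : l < j) : v j = 0 := by
  simpa [hj.not_gt, hj.ne'] using Fintype.mem_piFinset.1 hv j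

theorem card_messagesWithLast (l : Fin k) : (messagesWithLast l).card = 2 ^ (l : ℕ) := by
  simp [messagesWithLast, apply_ite Finset.card, Finset.prod_ite, Finset.filter_gt_eq_Iio]

theorem exists_mem_messagesWithLast (hv : v ≠ 0) : ∃ l, v ∈ messagesWithLast l := by
  obtain ⟨j, hj⟩ := Function.ne_iff.1 hv
  obtain ⟨l, hl, hmax⟩ :=
    (Finset.univ.filter fun j => v j ≠ 0).exists_maximal ⟨j, by simpa using hj⟩
  refine ⟨l, Fintype.mem_piFinset.2 fun j => ?_⟩
  split_ifs with hlt heq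
  · exact Finset.mem_univ _
  · rw [heq, Finset.mem_singleton]
    exact Fin.eq_one_of_ne_zero _ (Finset.mem_filter.1 hl).2
  · rw [Finset.mem_singleton]
    by_contra hj
    exact heq (le_antisymm (hmax (by simpa using hj) (not_lt.1 hlt)) (not_lt.1 hlt))

end Messages

section LeftWords

variable {n : ℕ}

/-- The binary words of length `n` supported on the first `s` columns. -/
def leftWords (n s : ℕ) : Finset (Fin n → ZMod 2) :=
  Fintype.piFinset fun i => if (i : ℕ) < s then Finset.univ else {0}

theorem apply_eq_zero_of_mem_leftWords {s : ℕ} {h : Fin n → ZMod 2} (hh : h ∈ leftWords n s)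
    {i : Fin n} (hi : s ≤ i) : h i = 0 := by
  simpa [hi.not_gt] using Fintype.mem_piFinset.1 hh i

theorem card_leftWords_ne_zero {R : Type*} [Semifield R] [NeZero (2 : R)] (s : ℕ) :
    ((leftWords n s).card : R) ≠ 0 := by
  simp [leftWords, apply_ite Finset.card, Finset.prod_ite, two_ne_zero]

theorem sum_leftWords_prod {R : Type*} [Semifield R] [NeZero (2 : R)] (s : ℕ)
    (f : Fin n → ZMod 2 → R) (x : Fin n → ZMod 2) :
    ∑ h ∈ leftWords n s, ∏ i, f i ((x + h) i) = (leftWords n s).card *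
      ∏ i : Fin n, if (i : ℕ) < s then (f i 0 + f i 1) / 2 else f i (x i) := by
  simp only [leftWords, Fintype.card_piFinset, Pi.add_apply]
  rw [← Finset.prod_univ_sum _ fun i a => f i (x i + a), Nat.cast_prod, ← Finset.prod_mul_distrib]
  refine Finset.prod_congr rfl fun i _ => ?_
  split_ifs
  · rw [Finset.card_univ, ZMod.card, Nat.cast_ofNat, mul_div_cancel₀ _ two_ne_zero]
    exact (Equiv.sum_comp (Equiv.addLeft (x i)) (f i)).trans (Fin.sum_univ_two (f i))
  · simp

end LeftWords

section Staircase

variable {k n : ℕ} {w : Fin k → ℕ} {l : Fin k} {v : Fin k → ZMod 2}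

theorem stairStart_add_eq_sum_Iic (w : Fin k → ℕ) (l : Fin k) :
    stairStart w l + w l = ∑ i ∈ Finset.Iic l, w i := by
  rw [stairStart, add_comm, ← Finset.sum_insert (by simp)]
  congr 1
  ext i
  simp [le_iff_eq_or_lt]

theorem stairStart_add_le_stairStart (w : Fin k → ℕ) {j l : Fin k} (h : j < l) :
    stairStart w j + w j ≤ stairStart w l := by
  rw [stairStart_add_eq_sum_Iic, stairStart]
  exact Finset.sum_le_sum_of_subset fun i hi => by simpa using (Finset.mem_Iic.1 hi).trans_lt h

theorem stairStart_add_le_sum (w : Fin k → ℕ) (l : Fin k) :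
    stairStart w l + w l ≤ ∑ i, w i := by
  rw [stairStart_add_eq_sum_Iic]
  exact Finset.sum_le_univ_sum_of_nonneg fun _ => Nat.zero_le _

theorem mem_staircaseEnsemble {G : Matrix (Fin k) (Fin n) (ZMod 2)} :
    G ∈ staircaseEnsemble n w ↔ IsStaircase w G := by
  simp [staircaseEnsemble]

theorem staircaseEnsemble_nonempty (n : ℕ) (w : Fin k → ℕ) :
    (staircaseEnsemble n w).Nonempty := by
  refine ⟨Matrix.of fun l j => if (j : ℕ) < stairStart w l + w l then 1 else 0,
    mem_staircaseEnsemble.2 fun l j => ⟨fun _ h => ?_, fun h => ?_⟩⟩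
  · simp [h]
  · simp [h.not_gt]

theorem IsStaircase.vecMul_eq_one {G : Matrix (Fin k) (Fin n) (ZMod 2)} (hG : IsStaircase w G)
    (hv : v ∈ messagesWithLast l) {i : Fin n} (h1 : stairStart w l ≤ i)
    (h2 : (i : ℕ) < stairStart w l + w l) : Matrix.vecMul v G i = 1 := by
  rw [Matrix.vecMul, dotProduct, Finset.sum_eq_single l]
  · rw [apply_eq_one_of_mem_messagesWithLast hv, (hG l i).1 h1 h2, one_mul]
  · intro j _ hj
    rcases lt_or_gt_of_ne hj with h | h
    · rw [(hG j i).2 ((stairStart_add_le_stairStart w h).trans h1), mul_zero]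
    · rw [apply_eq_zero_of_mem_messagesWithLast hv h, zero_mul]
  · simp

theorem IsStaircase.vecMul_eq_zero {G : Matrix (Fin k) (Fin n) (ZMod 2)} (hG : IsStaircase w G)
    (hv : v ∈ messagesWithLast l) {i : Fin n} (h : stairStart w l + w l ≤ i) :
    Matrix.vecMul v G i = 0 := by
  rw [Matrix.vecMul, dotProduct]
  refine Finset.sum_eq_zero fun j _ => ?_
  rcases lt_trichotomy j l with hj | rfl | hj
  · rw [(hG j i).2 ((stairStart_add_le_stairStart w hj).trans (le_self_add.trans h)), mul_zero]
  · rw [(hG j i).2 h, mul_zero]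
  · rw [apply_eq_zero_of_mem_messagesWithLast hv hj, zero_mul]

theorem IsStaircase.add_vecMulVec {G : Matrix (Fin k) (Fin n) (ZMod 2)} (hG : IsStaircase w G)
    {h : Fin n → ZMod 2} (hh : h ∈ leftWords n (stairStart w l)) :
    IsStaircase w (G + Matrix.vecMulVec (Pi.single l 1) h) := by
  intro j i
  rw [Matrix.add_apply, Matrix.vecMulVec_apply]
  rcases eq_or_ne j l with rfl | hj
  · refine ⟨fun h1 h2 => ?_, fun h1 => ?_⟩
    · rw [apply_eq_zero_of_mem_leftWords hh h1, mul_zero, add_zero, (hG j i).1 h1 h2]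
    · rw [apply_eq_zero_of_mem_leftWords hh (le_self_add.trans h1), mul_zero, add_zero,
        (hG j i).2 h1]
  · rw [Pi.single_eq_of_ne hj, zero_mul, add_zero]
    exact hG j i

theorem sum_staircaseEnsemble_vecMul_add {R : Type*} [AddCommMonoid R]
    (F : (Fin n → ZMod 2) → R) (hv : v ∈ messagesWithLast l) {h : Fin n → ZMod 2}
    (hh : h ∈ leftWords n (stairStart w l)) :
    ∑ G ∈ staircaseEnsemble n w, F (Matrix.vecMul v G + h) =
      ∑ G ∈ staircaseEnsemble n w, F (Matrix.vecMul v G) := by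
  set D : Matrix (Fin k) (Fin n) (ZMod 2) := Matrix.vecMulVec (Pi.single l 1) h
  have hmem : ∀ G ∈ staircaseEnsemble n w, G + D ∈ staircaseEnsemble n w := fun G hG =>
    mem_staircaseEnsemble.2 ((mem_staircaseEnsemble.1 hG).add_vecMulVec hh)
  have hinv : ∀ G ∈ staircaseEnsemble n w, G + D + D = G := fun G _ => by
    ext j i
    simp only [Matrix.add_apply, CharTwo.add_cancel_right]
  refine Finset.sum_nbij' (· + D) (· + D) hmem hmem hinv hinv fun G _ => ?_
  rw [Matrix.vecMul_add, Matrix.vecMul_vecMulVec, dotProduct_single,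
    apply_eq_one_of_mem_messagesWithLast hv, mul_one, one_smul]

/-- The mean of `φ` over column `i` of a random codeword whose message has last nonzero entry `l`:
the symbol there is uniform before the `l`-th stair, `1` on it and `0` after it. -/
def columnMean {R : Type*} [Semifield R] (w : Fin k → ℕ) (l : Fin k) (i : ℕ) (φ : ZMod 2 → R) :
    R :=
  if i < stairStart w l then (φ 0 + φ 1) / 2 else if i < stairStart w l + w l then φ 1 else φ 0

theorem sum_staircaseEnsemble_prod_vecMul {R : Type*} [Semifield R] [NeZero (2 : R)]
    (f : Fin n → ZMod 2 → R) (hv : v ∈ messagesWithLast l) :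
    ∑ G ∈ staircaseEnsemble n w, ∏ i, f i (Matrix.vecMul v G i) =
      (staircaseEnsemble n w).card * ∏ i : Fin n, columnMean w l i (f i) := by
  have hmean : ∀ G ∈ staircaseEnsemble n w,
      ∑ h ∈ leftWords n (stairStart w l), ∏ i, f i ((Matrix.vecMul v G + h) i) =
        (leftWords n (stairStart w l)).card * ∏ i : Fin n, columnMean w l i (f i) := by
    intro G hG
    rw [mem_staircaseEnsemble] at hG
    rw [sum_leftWords_prod]
    congr 1
    refine Finset.prod_congr rfl fun i _ => ?_
    unfold columnMean
    split_ifs with h1 h2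
    · rfl
    · rw [hG.vecMul_eq_one hv (not_lt.1 h1) h2]
    · rw [hG.vecMul_eq_zero hv (not_lt.1 h2)]
  refine mul_left_cancel₀ (card_leftWords_ne_zero (n := n) (stairStart w l)) ?_
  calc ((leftWords n (stairStart w l)).card : R) *
        ∑ G ∈ staircaseEnsemble n w, ∏ i, f i (Matrix.vecMul v G i)
      = ∑ h ∈ leftWords n (stairStart w l),
          ∑ G ∈ staircaseEnsemble n w, ∏ i, f i ((Matrix.vecMul v G + h) i) := by
        rw [← nsmul_eq_mul, ← Finset.sum_const]
        exact Finset.sum_congr rfl fun h hh =>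
          (sum_staircaseEnsemble_vecMul_add (fun c => ∏ i, f i (c i)) hv hh).symm
    _ = (leftWords n (stairStart w l)).card *
          ((staircaseEnsemble n w).card * ∏ i : Fin n, columnMean w l i (f i)) := by
        rw [Finset.sum_comm, Finset.sum_congr rfl hmean, Finset.sum_const, nsmul_eq_mul]
        ring

end Staircase

/-- The profile of length `n` with `m + 1` stairs that have width one, except for the first, which
has width `n - m` (where `m < n`). A message with last nonzero entry `l` is then protected by the
`n - m + l` columns up to the end of its stair, which suffices for every `l`. -/
def wideFirstProfile (m n : ℕ) : Fin (m + 1) → ℕ := Function.update 1 0 (n - m)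

theorem stairStart_add_wideFirstProfile (m n : ℕ) (l : Fin (m + 1)) :
    stairStart (wideFirstProfile m n) l + wideFirstProfile m n l = n - m + l := by
  rw [stairStart_add_eq_sum_Iic, wideFirstProfile,
    Finset.sum_update_of_mem (Finset.mem_Iic.2 (Fin.zero_le l))]
  simp [Finset.card_sdiff]

theorem isProfile_wideFirstProfile {m n : ℕ} (h : m < n) : IsProfile n (wideFirstProfile m n) := by
  refine ⟨fun l => ?_, ?_⟩
  · rcases eq_or_ne l 0 with rfl | hl
    · simpa [wideFirstProfile] using h
    · simp [wideFirstProfile, hl]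
  · rw [← Finset.Iic_top, ← stairStart_add_eq_sum_Iic, stairStart_add_wideFirstProfile]
    exact Nat.sub_add_cancel h.le

namespace BIOSChannel

variable {Y : Type*} [MeasurableSpace Y] (W : BIOSChannel Y) {k n : ℕ}

section Confusion

theorem measurable_likelihood (c : Fin n → ZMod 2) : Measurable (W.likelihood c) :=
  Finset.measurable_fun_prod _ fun i _ => (W.measurable_p (c i)).comp (measurable_pi_apply i)

/-- The event that the codeword of some message in `S` is at least as likely as the zero word. -/
def confusion (S : Finset (Fin k → ZMod 2)) (G : Matrix (Fin k) (Fin n) (ZMod 2)) :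
    Set (Fin n → Y) :=
  {y | ∃ v ∈ S, W.likelihood 0 y ≤ W.likelihood (Matrix.vecMul v G) y}

theorem measurableSet_confusion (S : Finset (Fin k → ZMod 2))
    (G : Matrix (Fin k) (Fin n) (ZMod 2)) : MeasurableSet (W.confusion S G) := by
  simp only [confusion, Set.ofPred_exists, Set.ofPred_and]
  exact MeasurableSet.iUnion fun v => (MeasurableSet.const _).inter
    (measurableSet_le (W.measurable_likelihood _) (W.measurable_likelihood _))

theorem confusion_subset_iUnion (S : Finset (Fin k → ZMod 2)) (hS : 0 ∉ S)
    (G : Matrix (Fin k) (Fin n) (ZMod 2)) :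
    W.confusion S G ⊆ ⋃ l, W.confusion (messagesWithLast l) G := by
  rintro y ⟨v, hv, hle⟩
  obtain ⟨l, hl⟩ := exists_mem_messagesWithLast (ne_of_mem_of_not_mem hv hS)
  exact Set.mem_iUnion.2 ⟨l, v, hl, hle⟩

variable {W} in
/-- By symmetry the error event of any message `u`, translated by its codeword, lies in the
confusion event of the zero word. -/
theorem IsMLDecoder.FER_le {G : Matrix (Fin k) (Fin n) (ZMod 2)}
    {dec : (Fin n → Y) → (Fin k → ZMod 2)} (hdec : W.IsMLDecoder G dec) :
    W.FER G dec ≤ (W.wordLaw 0).real (W.confusion {0}ᶜ G) := by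
  have hmessage (u : Fin k → ZMod 2) : (W.wordLaw (Matrix.vecMul u G)).real {y | dec y ≠ u} ≤
      (W.wordLaw 0).real (W.confusion {0}ᶜ G) := by
    rw [← (W.measurePreserving_outputShift_wordLaw (Matrix.vecMul u G)).measureReal_preimage
      (W.measurableSet_confusion _ G).nullMeasurableSet]
    refine measureReal_mono fun y hy => ⟨dec y - u, by simpa [sub_eq_zero] using hy, ?_⟩
    rw [← W.likelihood_add, ← W.likelihood_add, add_zero, ← Matrix.add_vecMul, add_sub_cancel]
    exact hdec y u
  rw [FER, div_le_iff₀ (by positivity)]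
  refine (Finset.sum_le_sum fun u _ => hmessage u).trans_eq ?_
  simp [mul_comm]

theorem likelihood_div_likelihood_zero (c : Fin n → ZMod 2) (y : Fin n → Y) :
    (W.likelihood c y / W.likelihood 0 y : ℝ) = ∏ i, W.likelihoodRatio (c i) (y i) := by
  simp only [likelihood, likelihoodRatio, NNReal.coe_prod, Finset.prod_div_distrib, Pi.zero_apply]

theorem indicator_confusion_le (S : Finset (Fin k → ZMod 2))
    (G : Matrix (Fin k) (Fin n) (ZMod 2)) {y : Fin n → Y} (hy : ∀ i, 0 < W.p 0 (y i)) :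
    (W.confusion S G).indicator 1 y ≤
      ∑ v ∈ S, ∏ i, W.likelihoodRatio (Matrix.vecMul v G i) (y i) := by
  have hnonneg (v : Fin k → ZMod 2) :
      0 ≤ ∏ i, W.likelihoodRatio (Matrix.vecMul v G i) (y i) :=
    Finset.prod_nonneg fun i _ => W.likelihoodRatio_nonneg _ _
  refine Set.indicator_apply_le' ?_ fun _ => Finset.sum_nonneg fun v _ => hnonneg v
  rintro ⟨v, hv, hle⟩
  have hpos : (0 : ℝ) < W.likelihood 0 y := NNReal.coe_pos.2 (Finset.prod_pos fun i _ => hy i)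
  calc (1 : ℝ) ≤ W.likelihood (Matrix.vecMul v G) y / W.likelihood 0 y :=
        (one_le_div hpos).2 (NNReal.coe_le_coe.2 hle)
    _ = ∏ i, W.likelihoodRatio (Matrix.vecMul v G i) (y i) :=
        W.likelihood_div_likelihood_zero _ y
    _ ≤ ∑ v ∈ S, ∏ i, W.likelihoodRatio (Matrix.vecMul v G i) (y i) :=
        Finset.single_le_sum (fun v _ => hnonneg v) hv

end Confusion

section UnionBound

variable (w : Fin k → ℕ) (l : Fin k)

theorem sum_indicator_confusion_le {ρ : ℝ} (h0 : 0 ≤ ρ) (h1 : ρ ≤ 1) {y : Fin n → Y}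
    (hy : ∀ i, 0 < W.p 0 (y i)) :
    ∑ G ∈ staircaseEnsemble n w, (W.confusion (messagesWithLast l) G).indicator 1 y ≤
      (staircaseEnsemble n w).card *
        (2 ^ (l : ℕ) * ∏ i : Fin n, columnMean w l i (W.likelihoodRatio · (y i))) ^ ρ := by
  have hcard : (0 : ℝ) < (staircaseEnsemble n w).card :=
    Nat.cast_pos.2 (staircaseEnsemble_nonempty n w).card_pos
  have hnonneg : 0 ≤ ∑ G ∈ staircaseEnsemble n w,
      (W.confusion (messagesWithLast l) G).indicator (1 : (Fin n → Y) → ℝ) y :=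
    Finset.sum_nonneg fun G _ => Set.indicator_nonneg (fun _ _ => zero_le_one) y
  have hone : ∑ G ∈ staircaseEnsemble n w,
      (W.confusion (messagesWithLast l) G).indicator (1 : (Fin n → Y) → ℝ) y ≤
        (staircaseEnsemble n w).card * 1 := by
    rw [← nsmul_eq_mul]
    exact Finset.sum_le_card_nsmul _ _ _ fun G _ =>
      Set.indicator_apply_le' (fun _ => le_rfl) fun _ => zero_le_one
  have hmean : ∑ G ∈ staircaseEnsemble n w,
      (W.confusion (messagesWithLast l) G).indicator (1 : (Fin n → Y) → ℝ) y ≤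
        (staircaseEnsemble n w).card *
          (2 ^ (l : ℕ) * ∏ i : Fin n, columnMean w l i (W.likelihoodRatio · (y i))) := by
    refine (Finset.sum_le_sum fun G _ => W.indicator_confusion_le _ G hy).trans_eq ?_
    rw [Finset.sum_comm, Finset.sum_congr rfl fun v hv =>
      sum_staircaseEnsemble_prod_vecMul (fun i x => W.likelihoodRatio x (y i)) hv,
      Finset.sum_const, card_messagesWithLast, nsmul_eq_mul, Nat.cast_pow, Nat.cast_ofNat,
      mul_left_comm]
  rw [← div_le_iff₀' hcard] at hone hmean ⊢
  exact le_rpow_of_le_one_of_le (div_nonneg hnonneg hcard.le) hone hmean h0 h1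

theorem columnMean_likelihoodRatio_nonneg (i : ℕ) (y : Y) :
    0 ≤ columnMean w l i (W.likelihoodRatio · y) := by
  have := W.likelihoodRatio_nonneg
  unfold columnMean
  split_ifs
  · exact div_nonneg (add_nonneg (this 0 y) (this 1 y)) zero_le_two
  · exact this 1 y
  · exact this 0 y

theorem integrable_columnMean_likelihoodRatio (i : ℕ) :
    Integrable (fun y => columnMean w l i (W.likelihoodRatio · y)) (W.law 0) := by
  unfold columnMean
  split_ifs
  · exact ((W.integrable_likelihoodRatio 0).add (W.integrable_likelihoodRatio 1)).div_const 2
  · exact W.integrable_likelihoodRatio 1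
  · exact W.integrable_likelihoodRatio 0

theorem integral_columnMean_likelihoodRatio_rpow (i : ℕ) (ρ : ℝ) :
    ∫ y, columnMean w l i (W.likelihoodRatio · y) ^ ρ ∂W.law 0 =
      if i < stairStart w l then ∫ y, W.outputRatio y ^ ρ ∂W.law 0
      else if i < stairStart w l + w l then ∫ y, W.likelihoodRatio 1 y ^ ρ ∂W.law 0 else 1 := by
  unfold columnMean
  split_ifs
  · simp only [outputRatio_eq_half_add]
  · rfl
  · have hae : ∀ᵐ y ∂W.law 0, W.likelihoodRatio 0 y ^ ρ = 1 := by
      filter_upwards [W.ae_law_p_pos 0] with y hy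
      rw [W.likelihoodRatio_zero hy, Real.one_rpow]
    simp [integral_congr_ae hae]

variable {w}

theorem integral_prod_columnMean_likelihoodRatio_rpow (hw : ∑ l, w l ≤ n) (ρ : ℝ) :
    ∫ y, ∏ i : Fin n, columnMean w l i (W.likelihoodRatio · (y i)) ^ ρ ∂W.wordLaw 0 =
      (∫ y, W.outputRatio y ^ ρ ∂W.law 0) ^ stairStart w l *
        (∫ y, W.likelihoodRatio 1 y ^ ρ ∂W.law 0) ^ w l := by
  simp only [wordLaw, Pi.zero_apply]
  rw [integral_fintype_prod_eq_prod
      (fun (i : Fin n) y => columnMean w l i (W.likelihoodRatio · y) ^ ρ),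
    ← prod_fin_ite_lt ((stairStart_add_le_sum w l).trans hw)]
  exact Finset.prod_congr rfl fun i _ => W.integral_columnMean_likelihoodRatio_rpow w l i ρ

theorem sum_measureReal_confusion_messagesWithLast_le (hw : ∑ l, w l ≤ n) {ρ : ℝ} (h0 : 0 ≤ ρ)
    (h1 : ρ ≤ 1) :
    ∑ G ∈ staircaseEnsemble n w, (W.wordLaw 0).real (W.confusion (messagesWithLast l) G) ≤
      (staircaseEnsemble n w).card * (2 ^ (ρ * l) *
        ((∫ y, W.outputRatio y ^ ρ ∂W.law 0) ^ stairStart w l *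
          (∫ y, W.likelihoodRatio 1 y ^ ρ ∂W.law 0) ^ w l)) := by
  have hrpow (y : Fin n → Y) :
      (2 ^ (l : ℕ) * ∏ i : Fin n, columnMean w l i (W.likelihoodRatio · (y i))) ^ ρ =
        2 ^ (ρ * l) * ∏ i : Fin n, columnMean w l i (W.likelihoodRatio · (y i)) ^ ρ := by
    have hnonneg (i : Fin n) := W.columnMean_likelihoodRatio_nonneg w l i (y i)
    rw [Real.mul_rpow (by positivity) (Finset.prod_nonneg fun i _ => hnonneg i),
      ← Real.finsetProd_rpow _ _ (fun i _ => hnonneg i), ← Real.rpow_natCast_mul two_pos.le,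
      mul_comm ρ]
  have hint : Integrable (fun y : Fin n → Y =>
      ∏ i : Fin n, columnMean w l i (W.likelihoodRatio · (y i)) ^ ρ) (W.wordLaw 0) :=
    Integrable.fintype_prod fun i : Fin n => integrable_rpow_of_le_one
      (W.integrable_columnMean_likelihoodRatio w l i)
      (ae_of_all _ (W.columnMean_likelihoodRatio_nonneg w l i)) h0 h1
  have hint' (G : Matrix (Fin k) (Fin n) (ZMod 2)) : Integrable
      ((W.confusion (messagesWithLast l) G).indicator (1 : (Fin n → Y) → ℝ)) (W.wordLaw 0) :=
    (integrable_const 1).indicator (W.measurableSet_confusion _ G)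
  calc ∑ G ∈ staircaseEnsemble n w, (W.wordLaw 0).real (W.confusion (messagesWithLast l) G)
      = ∫ y, ∑ G ∈ staircaseEnsemble n w,
          (W.confusion (messagesWithLast l) G).indicator (1 : (Fin n → Y) → ℝ) y
            ∂W.wordLaw 0 := by
        rw [integral_finsetSum _ fun G _ => hint' G]
        exact Finset.sum_congr rfl fun G _ =>
          (integral_indicator_one (W.measurableSet_confusion _ G)).symm
    _ ≤ ∫ y, (staircaseEnsemble n w).card *
          (2 ^ (ρ * l) * ∏ i : Fin n, columnMean w l i (W.likelihoodRatio · (y i)) ^ ρ)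
            ∂W.wordLaw 0 := by
        refine integral_mono_ae (integrable_finsetSum _ fun G _ => hint' G)
          ((hint.const_mul _).const_mul _) ?_
        filter_upwards [W.ae_wordLaw_p_pos 0] with y hy
        exact hrpow y ▸ W.sum_indicator_confusion_le w l h0 h1 hy
    _ = _ := by
        rw [integral_const_mul, integral_const_mul,
          W.integral_prod_columnMean_likelihoodRatio_rpow l hw ρ]

theorem sum_measureReal_confusion_le (hw : ∑ l, w l ≤ n) {ρ a : ℝ} (h0 : 0 ≤ ρ) (h1 : ρ ≤ 1)
    (ha : ∫ y, W.outputRatio y ^ ρ ∂W.law 0 ≤ a) (ha1 : a ≤ 1) :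
    ∑ G ∈ staircaseEnsemble n w, (W.wordLaw 0).real (W.confusion {0}ᶜ G) ≤
      (staircaseEnsemble n w).card * ∑ l : Fin k, 2 ^ (ρ * l) * a ^ (stairStart w l + w l) := by
  have hM0 : 0 ≤ ∫ y, W.outputRatio y ^ ρ ∂W.law 0 :=
    integral_nonneg fun y => Real.rpow_nonneg (W.outputRatio_nonneg y) ρ
  have ha0 : 0 ≤ a := hM0.trans ha
  have hB0 : 0 ≤ ∫ y, W.likelihoodRatio 1 y ^ ρ ∂W.law 0 :=
    integral_nonneg fun y => Real.rpow_nonneg (W.likelihoodRatio_nonneg 1 y) ρ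
  have hB : ∫ y, W.likelihoodRatio 1 y ^ ρ ∂W.law 0 ≤ a := by
    linarith [W.integral_likelihoodRatio_one_rpow_add_one_le h0 h1]
  calc ∑ G ∈ staircaseEnsemble n w, (W.wordLaw 0).real (W.confusion {0}ᶜ G)
      ≤ ∑ G ∈ staircaseEnsemble n w, ∑ l,
          (W.wordLaw 0).real (W.confusion (messagesWithLast l) G) :=
        Finset.sum_le_sum fun G _ => (measureReal_mono
          (W.confusion_subset_iUnion _ (by simp) G)).trans (measureReal_iUnion_fintype_le _)
    _ = ∑ l, ∑ G ∈ staircaseEnsemble n w,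
          (W.wordLaw 0).real (W.confusion (messagesWithLast l) G) := Finset.sum_comm
    _ ≤ (staircaseEnsemble n w).card *
          ∑ l : Fin k, 2 ^ (ρ * l) * a ^ (stairStart w l + w l) := by
        rw [Finset.mul_sum]
        refine Finset.sum_le_sum fun l _ =>
          (W.sum_measureReal_confusion_messagesWithLast_le l hw h0 h1).trans ?_
        rw [pow_add]
        gcongr

end UnionBound

section BelowCapacity

theorem sum_union_bound_wideFirstProfile_le {m n : ℕ} (h : m < n) {ρ c : ℝ} (hρ : 0 ≤ ρ)
    (hc : c ≤ 1) :
    ∑ l : Fin (m + 1), (2 : ℝ) ^ (ρ * l) *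
        (2 ^ (-(ρ * c))) ^ (stairStart (wideFirstProfile m n) l + wideFirstProfile m n l) ≤
      (m + 1) * 2 ^ (ρ * (m - c * n)) := by
  have hterm (l : Fin (m + 1)) : (2 : ℝ) ^ (ρ * l) *
      (2 ^ (-(ρ * c))) ^ (stairStart (wideFirstProfile m n) l + wideFirstProfile m n l) ≤
        2 ^ (ρ * (m - c * n)) := by
    have hl : (l : ℝ) ≤ m := Nat.cast_le.2 l.is_le
    rw [stairStart_add_wideFirstProfile, ← Real.rpow_mul_natCast two_pos.le,
      ← Real.rpow_add two_pos, Nat.cast_add, Nat.cast_sub h.le]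
    refine Real.rpow_le_rpow_of_exponent_le one_le_two ?_
    calc ρ * l + -(ρ * c) * (n - m + l) = ρ * (m - c * n - (1 - c) * (m - l)) := by ring
      _ ≤ ρ * (m - c * n) := mul_le_mul_of_nonneg_left
        (sub_le_self _ (mul_nonneg (sub_nonneg.2 hc) (sub_nonneg.2 hl))) hρ
  refine (Finset.sum_le_sum fun l _ => hterm l).trans_eq ?_
  simp

theorem exists_sum_measureReal_confusion_le {ε δ : ℝ} (hε : 0 < ε) (hδ : 0 < δ)
    (hδC : δ < W.capacity) :
    ∃ N : ℕ, ∀ n ≥ N, ∀ m < n, (m : ℝ) ≤ n * (W.capacity - δ) →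
      ∑ G ∈ staircaseEnsemble n (wideFirstProfile m n), (W.wordLaw 0).real (W.confusion {0}ᶜ G) ≤
        (staircaseEnsemble n (wideFirstProfile m n)).card * ε := by
  set c := W.capacity - δ / 2 with hc
  obtain ⟨ρ, ⟨hρ0, hρ1⟩, hM⟩ := W.exists_integral_outputRatio_rpow_le
    (show c < W.capacity from sub_lt_self _ (half_pos hδ))
  have hc0 : 0 < c := by linarith
  have hc1 : c ≤ 1 := by linarith [W.capacity_le_one]
  have ha1 : (2 : ℝ) ^ (-(ρ * c)) ≤ 1 :=
    Real.rpow_le_one_of_one_le_of_nonpos one_le_two (neg_nonpos.2 (by positivity))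
  set q : ℝ := 2 ^ (-(ρ * (δ / 2)))
  have hq1 : q < 1 :=
    Real.rpow_lt_one_of_one_lt_of_neg one_lt_two (neg_neg_of_pos (by positivity))
  obtain ⟨N, hN⟩ := eventually_atTop.1 ((tendsto_self_mul_const_pow_of_lt_one
    (by positivity) hq1).eventually_le_const hε)
  refine ⟨N, fun n hn m hmn hm => ?_⟩
  have hexp : (2 : ℝ) ^ (ρ * (m - c * n)) ≤ q ^ n := by
    rw [← Real.rpow_mul_natCast two_pos.le]
    refine Real.rpow_le_rpow_of_exponent_le one_le_two ?_
    calc ρ * (m - c * n) ≤ ρ * (n * (W.capacity - δ) - c * n) := by gcongr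
      _ = -(ρ * (δ / 2)) * n := by rw [hc]; ring
  have hm1 : (m + 1 : ℝ) ≤ n := by exact_mod_cast hmn
  refine (W.sum_measureReal_confusion_le (isProfile_wideFirstProfile hmn).2.le hρ0.le hρ1
    hM ha1).trans (mul_le_mul_of_nonneg_left ?_ (Nat.cast_nonneg _))
  calc ∑ l : Fin (m + 1), (2 : ℝ) ^ (ρ * l) *
        (2 ^ (-(ρ * c))) ^ (stairStart (wideFirstProfile m n) l + wideFirstProfile m n l)
      ≤ (m + 1) * 2 ^ (ρ * (m - c * n)) := sum_union_bound_wideFirstProfile_le hmn hρ0.le hc1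
    _ ≤ n * q ^ n := by gcongr
    _ ≤ ε := hN n hn

end BelowCapacity

section Ensemble

variable {W} {w : Fin k → ℕ} {ε : ℝ}

theorem exists_isStaircase_FER_le
    (h : ∑ G ∈ staircaseEnsemble n w, (W.wordLaw 0).real (W.confusion {0}ᶜ G) ≤
      (staircaseEnsemble n w).card * ε) :
    ∃ G : Matrix (Fin k) (Fin n) (ZMod 2), IsStaircase w G ∧
      ∀ dec : (Fin n → Y) → (Fin k → ZMod 2), W.IsMLDecoder G dec → W.FER G dec ≤ ε := by
  obtain ⟨G, hG, hle⟩ := Finset.exists_le_of_sum_le (staircaseEnsemble_nonempty n w)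
    (h.trans_eq (by rw [Finset.sum_const, nsmul_eq_mul]) : _ ≤ ∑ _G ∈ staircaseEnsemble n w, ε)
  exact ⟨G, mem_staircaseEnsemble.1 hG, fun dec hdec => hdec.FER_le.trans hle⟩

theorem avgFER_le
    (h : ∑ G ∈ staircaseEnsemble n w, (W.wordLaw 0).real (W.confusion {0}ᶜ G) ≤
      (staircaseEnsemble n w).card * ε)
    {dec : Matrix (Fin k) (Fin n) (ZMod 2) → (Fin n → Y) → (Fin k → ZMod 2)}
    (hdec : ∀ G, IsStaircase w G → W.IsMLDecoder G (dec G)) : W.avgFER w dec ≤ ε := by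
  rw [avgFER, div_le_iff₀' (Nat.cast_pos.2 (staircaseEnsemble_nonempty n w).card_pos)]
  exact (Finset.sum_le_sum fun G hG => (hdec G (mem_staircaseEnsemble.1 hG)).FER_le).trans h

end Ensemble

end BIOSChannel

theorem ceil_mul_sub_bounds {C δ : ℝ} {n : ℕ} (hδ : δ < C) (hC : C ≤ 1) (hnδ : 1 ≤ n * δ) :
    0 < ⌈(n : ℝ) * (C - δ)⌉₊ ∧ ⌈(n : ℝ) * (C - δ)⌉₊ < n ∧
      C - δ ≤ (⌈(n : ℝ) * (C - δ)⌉₊ : ℝ) / n ∧ (⌈(n : ℝ) * (C - δ)⌉₊ : ℝ) / n < C := by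
  have hn0 : (0 : ℝ) < n := by
    refine Nat.cast_pos.2 (Nat.pos_of_ne_zero ?_)
    rintro rfl
    norm_num at hnδ
  have hpos : 0 < n * (C - δ) := mul_pos hn0 (sub_pos.2 hδ)
  have hupper : (⌈(n : ℝ) * (C - δ)⌉₊ : ℝ) < n * C := by
    linarith [Nat.ceil_lt_add_one hpos.le]
  refine ⟨Nat.ceil_pos.2 hpos, ?_, (le_div_iff₀' hn0).2 (Nat.le_ceil _),
    (div_lt_iff₀' hn0).2 hupper⟩
  exact_mod_cast hupper.trans_le (mul_le_of_le_one_right hn0.le hC)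

theorem theorem2 {Y : Type*} [MeasurableSpace Y] (W : BIOSChannel Y) (ε δ : ℝ)
    (hε : 0 < ε) (hδ : 0 < δ) (hδC : δ < W.capacity) :
    ∃ nT : ℕ, ∀ n : ℕ, nT ≤ n → ∀ k : ℕ, k = ⌈(n : ℝ) * (W.capacity - δ)⌉₊ →
      0 < k ∧ k < n ∧
      W.capacity - δ ≤ (k : ℝ) / (n : ℝ) ∧ (k : ℝ) / (n : ℝ) < W.capacity ∧
      ∃ w : Fin k → ℕ, IsProfile n w ∧
        -- some staircase generator matrix is good under every ML decoder
        (∃ G : Matrix (Fin k) (Fin n) (ZMod 2), IsStaircase w G ∧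
          ∀ dec : (Fin n → Y) → (Fin k → ZMod 2), W.IsMLDecoder G dec → W.FER G dec ≤ ε) ∧
        -- and the random staircase code of this profile is good on average
        (∀ dec : Matrix (Fin k) (Fin n) (ZMod 2) → (Fin n → Y) → (Fin k → ZMod 2),
          (∀ G, IsStaircase w G → W.IsMLDecoder G (dec G)) → W.avgFER w dec ≤ ε) := by
  obtain ⟨N, hN⟩ := W.exists_sum_measureReal_confusion_le hε hδ hδC
  refine ⟨max N (⌈δ⁻¹⌉₊ + 1), fun n hn k hk => ?_⟩
  have hnδ : 1 ≤ n * δ := by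
    rw [← inv_le_iff_one_le_mul₀ hδ]
    exact Nat.ceil_le.1 (by omega)
  obtain ⟨hk0, hkn, hlower, hupper⟩ :=
    hk ▸ ceil_mul_sub_bounds hδC W.capacity_le_one hnδ
  obtain ⟨m, rfl⟩ := Nat.exists_eq_add_one.2 hk0
  have hmn : m < n := by omega
  have hm : (m : ℝ) ≤ n * (W.capacity - δ) := (Nat.lt_ceil.1 (by omega)).le
  have hsum := hN n (by omega) m hmn hm
  exact ⟨hk0, hkn, hlower, hupper, wideFirstProfile m n, isProfile_wideFirstProfile hmn,
    BIOSChannel.exists_isStaircase_FER_le hsum, fun _ => BIOSChannel.avgFER_le hsum⟩
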